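/- Let $\psi=\Gamma'/\Gamma$ be the digamma function, $\psi_1=\psi'$ the trigamma function, and $\zeta$ the Riemann zeta function. Then the following series converge (absolutely) and $$\sum_{m=1}^\infty \frac{1}{m^3\binom{2m}{m}} = -\frac{4}{3}\zeta(3)+\frac{\pi\sqrt3}{18}\left(\psi_1\left(\tfrac13\right)-\psi_1\left(\tfrac23\right)\right).$$ Equivalently, in factorial form, $$\sum_{n=1}^\infty \frac{(n!)^2}{n^3(2n)!} = 4\left\{\frac{\pi\sqrt3}{72}\left[\psi_1\left(\tfrac13\right)-\psi_1\left(\tfrac23\right)\right]-\frac13\zeta(3)\right\}.$$ The common value differs from $0.5229$ by less than $5\cdot 10^{-5}$. -/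

import Mathlib

/-- The trigamma function `ψ₁ = ψ⁽¹⁾`, the derivative of the digamma function `ψ = Γ' / Γ`. -/
noncomputable def trigamma : ℂ → ℂ := deriv Complex.digamma

/-!
With `wₙ = 4ⁿ / (n (2n choose n))`, the sum is the value at `x = 1 / 4` of `H(x) = ∑ wₙ xⁿ / n²`.
The recurrence `(2n + 1) wₙ₊₁ = 2n wₙ` says that `P(x) = ∑ wₙ₊₁ xⁿ` solves the differential
equation `(1 - 2x) P + 2x (1 - x) P' = 2` (`centralSeries_ode`). For `x = sin² θ` it reads
`(sin θ cos θ P(sin² θ))' = 2`; one more integration gives the classical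
`∑ wₙ sin²ⁿ θ / n = 2 θ²` (`centralSeriesDiv_one_sin_sq`), and therefore
`d/dθ H(sin² θ) = 4 θ² cot θ`.

An antiderivative of `4 θ² cot θ` is `4 θ² log (2 sin θ) + 4 θ Cl₂(2θ) + 2 Cl₃(2θ)`, where
`Cl₂ t = ∑ sin (nt) / n²` and `Cl₃ t = ∑ cos (nt) / n³` are the Clausen functions, because
`Cl₃' = -Cl₂` and `Cl₂' t = -log (2 sin (t / 2))` on `(0, 2π)` (`hasDerivAt_clausenTwo`).
Comparing the values at `0` and at `π / 6`, where `2 sin θ = 1`, gives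
`H(1/4) = (2π/3) Cl₂(π/3) + 2 Cl₃(π/3) - 2 Cl₃(0)` (`centralSeriesDiv_two_one_div_four`).

Splitting by the parity and the residue modulo `3` of the index gives `Cl₃(π/3) = ζ(3) / 3` and
`Cl₂(π/3) = (3√3/4) ∑ (1/(3n+1)² - 1/(3n+2)²)`. The last series is `(ψ₁(1/3) - ψ₁(2/3)) / 9` by
the expansion `ψ₁(x) = ∑ 1/(x+k)²` (`trigamma_ofReal`), which comes from the functional equation
and the log-convexity of `Γ`.
-/

open Filter Topology

/-! ### Functions with equal derivatives -/

theorem sub_eq_sub_of_hasDerivAt_eq {f g f' : ℝ → ℝ} {a b : ℝ} (hab : a < b)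
    (hf : ContinuousOn f (Set.Icc a b)) (hg : ContinuousOn g (Set.Icc a b))
    (hf' : ∀ x ∈ Set.Ioo a b, HasDerivAt f (f' x) x)
    (hg' : ∀ x ∈ Set.Ioo a b, HasDerivAt g (f' x) x) :
    f b - f a = g b - g a := by
  obtain ⟨c, -, hc⟩ := exists_hasDerivAt_eq_slope (fun x => f x - g x) (fun x => f' x - f' x) hab
    (hf.sub hg) (fun x hx => (hf' x hx).sub (hg' x hx))
  rw [sub_self, eq_comm, div_eq_zero_iff] at hc
  rcases hc with hc | hc <;> linarith

/-! ### Power series with bounded coefficients -/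

theorem summable_mul_pow_of_bounded {a : ℕ → ℝ} {C x : ℝ} (ha : ∀ n, |a n| ≤ C) (hx : |x| < 1) :
    Summable fun n => a n * x ^ n := by
  refine Summable.of_norm_bounded
    ((summable_geometric_of_lt_one (abs_nonneg x) hx).mul_left C) fun n => ?_
  rw [Real.norm_eq_abs, abs_mul, abs_pow]
  exact mul_le_mul_of_nonneg_right (ha n) (by positivity)

theorem summable_natCast_mul_pow_pred {r : ℝ} (hr0 : 0 < r) (hr : r < 1) :
    Summable fun n : ℕ => (n : ℝ) * r ^ (n - 1) := by
  have h := (hasSum_coe_mul_geometric_of_norm_lt_one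
    (show ‖r‖ < 1 by rwa [Real.norm_of_nonneg hr0.le])).summable.div_const r
  refine h.congr fun n => ?_
  rcases n with _ | n
  · simp
  · rw [Nat.add_sub_cancel, pow_succ]
    field_simp

theorem summable_mul_natCast_mul_pow_pred {a : ℕ → ℝ} {C x : ℝ} (ha : ∀ n, |a n| ≤ C)
    (hx : |x| < 1) : Summable fun n : ℕ => a n * (n * x ^ (n - 1)) := by
  obtain ⟨r, hxr, hr⟩ := exists_between hx
  have hr0 := (abs_nonneg x).trans_lt hxr
  refine Summable.of_norm_bounded ((summable_natCast_mul_pow_pred hr0 hr).mul_left C) fun n => ?_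
  rw [Real.norm_eq_abs, abs_mul, abs_mul, abs_pow, Nat.abs_cast]
  have := (abs_nonneg _).trans (ha 0)
  gcongr
  exact ha n

theorem hasDerivAt_tsum_mul_pow {a : ℕ → ℝ} {C x : ℝ} (ha : ∀ n, |a n| ≤ C) (hx : |x| < 1) :
    HasDerivAt (fun y => ∑' n, a n * y ^ n) (∑' n, a n * (n * x ^ (n - 1))) x := by
  obtain ⟨r, hxr, hr⟩ := exists_between hx
  have hr0 := (abs_nonneg x).trans_lt hxr
  have hC := (abs_nonneg _).trans (ha 0)
  refine hasDerivAt_tsum_of_isPreconnected (t := Set.Ioo (-r) r) (y₀ := 0)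
    ((summable_natCast_mul_pow_pred hr0 hr).mul_left C) isOpen_Ioo isPreconnected_Ioo
    (fun n y _ => (hasDerivAt_pow n y).const_mul (a n)) (fun n y hy => ?_) ⟨by linarith, hr0⟩
    (summable_mul_pow_of_bounded ha (by simp)) (abs_lt.mp hxr)
  rw [Real.norm_eq_abs, abs_mul, abs_mul, abs_pow, Nat.abs_cast]
  have := (abs_lt.mpr hy).le
  gcongr
  exact ha n

/-! ### The power series of reciprocal central binomial coefficients -/

/-- The coefficient `4ⁿ / (n * (2n choose n))`; it vanishes at `n = 0` because `1 / 0 = 0`. -/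
noncomputable def centralCoeff (n : ℕ) : ℝ := 4 ^ n / (n * n.centralBinom)

theorem centralCoeff_nonneg (n : ℕ) : 0 ≤ centralCoeff n := by
  unfold centralCoeff; positivity

theorem centralCoeff_zero : centralCoeff 0 = 0 := by simp [centralCoeff]

theorem centralCoeff_one : centralCoeff 1 = 2 := by
  norm_num [centralCoeff, Nat.centralBinom, Nat.choose]

theorem centralCoeff_le_two (n : ℕ) : centralCoeff n ≤ 2 := by
  rcases n.eq_zero_or_pos with rfl | hn
  · simp [centralCoeff_zero]
  · have h := Nat.four_pow_le_two_mul_self_mul_centralBinom n hn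
    have h' : (4 : ℝ) ^ n ≤ 2 * n * n.centralBinom := by exact_mod_cast h
    have := n.centralBinom_pos
    rw [centralCoeff, div_le_iff₀ (by positivity)]
    linarith

theorem centralCoeff_succ_succ (n : ℕ) :
    (2 * n + 3) * centralCoeff (n + 2) = 2 * (n + 1) * centralCoeff (n + 1) := by
  have h : ((n : ℝ) + 1 + 1) * (n + 1 + 1).centralBinom
      = 2 * (2 * (n + 1) + 1) * (n + 1).centralBinom := by
    exact_mod_cast Nat.succ_mul_centralBinom_succ (n + 1)
  have hc : ((n + 1).centralBinom : ℝ) ≠ 0 := by exact_mod_cast (n + 1).centralBinom_ne_zero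
  unfold centralCoeff
  rw [show n + 2 = n + 1 + 1 from rfl]
  push_cast
  rw [h]
  have : (2 * (n : ℝ) + 3) ≠ 0 := by positivity
  field_simp
  ring

theorem abs_centralCoeff_succ_le (n : ℕ) : |centralCoeff (n + 1)| ≤ 2 := by
  rw [abs_of_nonneg (centralCoeff_nonneg _)]
  exact centralCoeff_le_two _

theorem abs_centralCoeff_div_pow_le (k n : ℕ) : |centralCoeff n / n ^ k| ≤ 2 := by
  rw [abs_of_nonneg (div_nonneg (centralCoeff_nonneg _) (by positivity))]
  rcases n.eq_zero_or_pos with rfl | hn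
  · simp [centralCoeff_zero]
  · have : (1 : ℝ) ≤ n := by exact_mod_cast hn
    exact (div_le_self (centralCoeff_nonneg _) (one_le_pow₀ this)).trans (centralCoeff_le_two n)

/-- The generating function `∑ 4ⁿ⁺¹ xⁿ / ((n+1) (2n+2 choose n+1))`. -/
noncomputable def centralSeries (x : ℝ) : ℝ := ∑' n : ℕ, centralCoeff (n + 1) * x ^ n

/-- The series `∑ 4ⁿ xⁿ / (nᵏ⁺¹ (2n choose n))`. -/
noncomputable def centralSeriesDiv (k : ℕ) (x : ℝ) : ℝ := ∑' n : ℕ, centralCoeff n / n ^ k * x ^ n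

/-- The two-term recurrence of the coefficients, as a first order differential equation. -/
theorem centralSeries_ode {x : ℝ} (hx : |x| < 1) :
    ∃ d, HasDerivAt centralSeries d x ∧
      (1 - 2 * x) * centralSeries x + 2 * x * (1 - x) * d = 2 := by
  refine ⟨_, hasDerivAt_tsum_mul_pow abs_centralCoeff_succ_le hx, ?_⟩
  have hS := (summable_mul_pow_of_bounded abs_centralCoeff_succ_le hx).hasSum
  have hD := (summable_mul_natCast_mul_pow_pred abs_centralCoeff_succ_le hx).hasSum
  change HasSum _ (centralSeries x) at hS
  set d := ∑' n : ℕ, centralCoeff (n + 1) * (n * x ^ (n - 1))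
  have h1 : HasSum (fun n : ℕ => (2 * n + 1) * centralCoeff (n + 1) * x ^ n)
      (centralSeries x + 2 * x * d) := by
    refine (hS.add (hD.mul_left (2 * x))).congr_fun fun n => ?_
    rcases n with _ | n
    · simp
    · rw [Nat.add_sub_cancel]
      push_cast
      ring
  have h2 : HasSum (fun n : ℕ => (2 * (n + 1 : ℕ) + 1) * centralCoeff (n + 1 + 1) * x ^ (n + 1))
      (2 * x * centralSeries x + 2 * x ^ 2 * d) := by
    refine ((hS.mul_left (2 * x)).add (hD.mul_left (2 * x ^ 2))).congr_fun fun n => ?_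
    have h := centralCoeff_succ_succ n
    push_cast
    rw [show 2 * ((n : ℝ) + 1) + 1 = 2 * n + 3 by ring, show n + 1 + 1 = n + 2 from rfl, h]
    rcases n with _ | n
    · simp
      ring
    · rw [Nat.add_sub_cancel]
      push_cast
      ring
  have h3 := h1.tsum_eq
  rw [h1.summable.tsum_eq_zero_add, h2.tsum_eq] at h3
  norm_num [centralCoeff_one] at h3
  linarith

theorem hasDerivAt_centralSeriesDiv_one {x : ℝ} (hx : |x| < 1) :
    HasDerivAt (centralSeriesDiv 1) (centralSeries x) x := by
  refine (hasDerivAt_tsum_mul_pow (abs_centralCoeff_div_pow_le 1) hx).congr_deriv ?_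
  rw [(summable_mul_natCast_mul_pow_pred (abs_centralCoeff_div_pow_le 1) hx).tsum_eq_zero_add]
  simp only [centralSeries, CharP.cast_eq_zero, zero_mul, mul_zero, zero_add]
  refine tsum_congr fun n => ?_
  rw [Nat.add_sub_cancel]
  have : ((n + 1 : ℕ) : ℝ) ≠ 0 := by positivity
  field_simp

theorem hasDerivAt_centralSeriesDiv_two {x : ℝ} (hx : |x| < 1) :
    ∃ d, HasDerivAt (centralSeriesDiv 2) d x ∧ x * d = centralSeriesDiv 1 x := by
  refine ⟨_, hasDerivAt_tsum_mul_pow (abs_centralCoeff_div_pow_le 2) hx, ?_⟩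
  rw [← tsum_mul_left, centralSeriesDiv]
  refine tsum_congr fun n => ?_
  rcases n with _ | n
  · simp [centralCoeff_zero]
  · rw [Nat.add_sub_cancel]
    have : ((n + 1 : ℕ) : ℝ) ≠ 0 := by positivity
    field_simp
    ring

theorem centralSeriesDiv_zero (k : ℕ) : centralSeriesDiv k 0 = 0 := by
  rw [centralSeriesDiv, tsum_eq_single 0]
  · simp [centralCoeff_zero]
  · intro n hn
    simp [hn]

theorem abs_sin_sq_lt_one {θ : ℝ} (h0 : 0 ≤ θ) (h1 : θ ≤ Real.pi / 6) :
    |Real.sin θ ^ 2| < 1 := by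
  have hpi := Real.pi_pos
  have h := Real.sin_lt_sin_of_lt_of_le_pi_div_two (x := θ) (y := Real.pi / 2)
    (by linarith) le_rfl (by linarith)
  have h' := Real.sin_nonneg_of_nonneg_of_le_pi h0 (by linarith)
  rw [Real.sin_pi_div_two] at h
  rw [abs_of_nonneg (by positivity)]
  nlinarith

theorem hasDerivAt_sin_sq (θ : ℝ) :
    HasDerivAt (fun t => Real.sin t ^ 2) (2 * Real.sin θ * Real.cos θ) θ := by
  refine ((Real.hasDerivAt_sin θ).pow 2).congr_deriv ?_
  norm_num

/-- In the variable `x = sin² θ` the differential equation integrates to a linear function. -/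
theorem sin_mul_cos_mul_centralSeries {θ : ℝ} (h0 : 0 < θ) (h1 : θ ≤ Real.pi / 6) :
    Real.sin θ * Real.cos θ * centralSeries (Real.sin θ ^ 2) = 2 * θ := by
  have key : ∀ t ∈ Set.Icc 0 θ, HasDerivAt
      (fun t => Real.sin t * Real.cos t * centralSeries (Real.sin t ^ 2)) 2 t := by
    intro t ht
    obtain ⟨d, hd, hode⟩ := centralSeries_ode (abs_sin_sq_lt_one ht.1 (ht.2.trans h1))
    have h := ((Real.hasDerivAt_sin t).mul (Real.hasDerivAt_cos t)).mul
      (HasDerivAt.comp t hd (hasDerivAt_sin_sq t))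
    refine h.congr_deriv ?_
    have hc := Real.cos_sq' t
    simp only [Function.comp, Pi.mul_apply]
    linear_combination
      (centralSeries (Real.sin t ^ 2) + 2 * Real.sin t ^ 2 * d) * hc + hode
  have h := sub_eq_sub_of_hasDerivAt_eq (g := fun t => 2 * t) (f' := fun _ => 2) h0
    (fun t ht => (key t ht).continuousAt.continuousWithinAt) (by fun_prop)
    (fun t ht => key t (Set.Ioo_subset_Icc_self ht))
    (fun t _ => by simpa using (hasDerivAt_id t).const_mul 2)
  simpa using h

/-- The expansion `∑ (2 sin θ)²ⁿ / (n² (2n choose n)) = 2 θ²` of the squared arcsine. -/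
theorem centralSeriesDiv_one_sin_sq {θ : ℝ} (h0 : 0 < θ) (h1 : θ ≤ Real.pi / 6) :
    centralSeriesDiv 1 (Real.sin θ ^ 2) = 2 * θ ^ 2 := by
  have key : ∀ t ∈ Set.Icc 0 θ, HasDerivAt (fun t => centralSeriesDiv 1 (Real.sin t ^ 2))
      (centralSeries (Real.sin t ^ 2) * (2 * Real.sin t * Real.cos t)) t := fun t ht =>
    HasDerivAt.comp t (hasDerivAt_centralSeriesDiv_one (abs_sin_sq_lt_one ht.1 (ht.2.trans h1)))
      (hasDerivAt_sin_sq t)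
  have h := sub_eq_sub_of_hasDerivAt_eq (g := fun t => 2 * t ^ 2) h0
    (fun t ht => (key t ht).continuousAt.continuousWithinAt) (by fun_prop)
    (fun t ht => key t (Set.Ioo_subset_Icc_self ht)) (fun t ht => by
      refine ((hasDerivAt_pow 2 t).const_mul 2).congr_deriv ?_
      have := sin_mul_cos_mul_centralSeries ht.1 (ht.2.le.trans h1)
      norm_num
      linarith)
  simpa [centralSeriesDiv_zero] using h

theorem hasDerivAt_centralSeriesDiv_two_sin_sq {θ : ℝ} (h0 : 0 < θ) (h1 : θ ≤ Real.pi / 6) :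
    HasDerivAt (fun t => centralSeriesDiv 2 (Real.sin t ^ 2))
      (4 * θ ^ 2 * (Real.cos θ / Real.sin θ)) θ := by
  obtain ⟨d, hd, hA⟩ := hasDerivAt_centralSeriesDiv_two (abs_sin_sq_lt_one h0.le h1)
  refine (HasDerivAt.comp θ hd (hasDerivAt_sin_sq θ)).congr_deriv ?_
  rw [centralSeriesDiv_one_sin_sq h0 h1] at hA
  have hs : Real.sin θ ≠ 0 :=
    (Real.sin_pos_of_pos_of_lt_pi h0 (by linarith [Real.pi_pos])).ne'
  field_simp
  linear_combination 2 * Real.cos θ * hA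

/-! ### Clausen functions -/

/-- The Clausen function `Cl₂ t = ∑ sin (n t) / n²`; the term `n = 0` vanishes. -/
noncomputable def clausenTwo (t : ℝ) : ℝ := ∑' n : ℕ, Real.sin (n * t) / (n : ℝ) ^ 2

/-- The Clausen function `Cl₃ t = ∑ cos (n t) / n³`; the term `n = 0` vanishes. -/
noncomputable def clausenThree (t : ℝ) : ℝ := ∑' n : ℕ, Real.cos (n * t) / (n : ℝ) ^ 3

theorem summable_one_div_natCast_sq : Summable fun n : ℕ => 1 / (n : ℝ) ^ 2 :=
  Real.summable_one_div_nat_pow.mpr one_lt_two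

theorem norm_sin_div_natCast_sq_le (n : ℕ) (t : ℝ) :
    ‖Real.sin (n * t) / (n : ℝ) ^ 2‖ ≤ 1 / (n : ℝ) ^ 2 := by
  rw [norm_div, Real.norm_eq_abs, norm_pow, RCLike.norm_natCast]
  gcongr
  exact Real.abs_sin_le_one _

theorem norm_cos_div_natCast_cube_le (n : ℕ) (t : ℝ) :
    ‖Real.cos (n * t) / (n : ℝ) ^ 3‖ ≤ 1 / (n : ℝ) ^ 3 := by
  rw [norm_div, Real.norm_eq_abs, norm_pow, RCLike.norm_natCast]
  gcongr
  exact Real.abs_cos_le_one _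

theorem summable_clausenTwo (t : ℝ) : Summable fun n : ℕ => Real.sin (n * t) / (n : ℝ) ^ 2 :=
  Summable.of_norm_bounded summable_one_div_natCast_sq fun n => norm_sin_div_natCast_sq_le n t

theorem summable_clausenThree (t : ℝ) : Summable fun n : ℕ => Real.cos (n * t) / (n : ℝ) ^ 3 :=
  Summable.of_norm_bounded (Real.summable_one_div_nat_pow.mpr (by norm_num))
    fun n => norm_cos_div_natCast_cube_le n t

theorem continuous_clausenTwo : Continuous clausenTwo :=
  continuous_tsum (fun n => by fun_prop) summable_one_div_natCast_sq norm_sin_div_natCast_sq_le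

theorem hasDerivAt_clausenThree (t : ℝ) : HasDerivAt clausenThree (-clausenTwo t) t := by
  have h := hasDerivAt_tsum (g := fun (n : ℕ) t => Real.cos (n * t) / (n : ℝ) ^ 3)
    (g' := fun (n : ℕ) t => -(Real.sin (n * t) / (n : ℝ) ^ 2)) (y₀ := 0)
    summable_one_div_natCast_sq (fun n y => ?_)
    (fun n y => by rw [norm_neg]; exact norm_sin_div_natCast_sq_le n y)
    (summable_clausenThree 0) t
  · rwa [tsum_neg] at h
  · refine ((((hasDerivAt_id y).const_mul (n : ℝ)).cos).div_const ((n : ℝ) ^ 3)).congr_deriv ?_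
    rcases n.eq_zero_or_pos with rfl | hn
    · simp
    · have : (n : ℝ) ≠ 0 := by positivity
      simp only [id]
      field_simp

theorem hasSum_pow_mul_cos_div {r : ℝ} (hr0 : 0 ≤ r) (hr : r < 1) (y : ℝ) :
    HasSum (fun n : ℕ => r ^ n * (Real.cos (n * y) / n))
      (-Real.log ‖1 - (r : ℂ) * Complex.exp (Complex.I * y)‖) := by
  have hz : ‖(r : ℂ) * Complex.exp (Complex.I * y)‖ < 1 := by
    rw [norm_mul, mul_comm Complex.I, Complex.norm_exp_ofReal_mul_I, mul_one, Complex.norm_real,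
      Real.norm_of_nonneg hr0]
    exact hr
  have h := Complex.hasSum_re (Complex.hasSum_taylorSeries_neg_log hz)
  rw [Complex.neg_re, Complex.log_re] at h
  refine h.congr_fun fun n => ?_
  rw [mul_pow, ← Complex.exp_nat_mul, Complex.div_natCast_re, ← Complex.ofReal_pow,
    Complex.re_ofReal_mul, show (n : ℂ) * (Complex.I * y) = ((n * y : ℝ) : ℂ) * Complex.I by
      push_cast; ring, Complex.exp_ofReal_mul_I_re, mul_div_assoc]

theorem hasDerivAt_tsum_pow_mul_sin_div_sq {r : ℝ} (hr0 : 0 ≤ r) (hr : r < 1) (y : ℝ) :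
    HasDerivAt (fun t => ∑' n : ℕ, r ^ n * (Real.sin (n * t) / (n : ℝ) ^ 2))
      (-Real.log ‖1 - (r : ℂ) * Complex.exp (Complex.I * y)‖) y := by
  rw [← (hasSum_pow_mul_cos_div hr0 hr y).tsum_eq]
  refine hasDerivAt_tsum (g := fun (n : ℕ) t => r ^ n * (Real.sin (n * t) / (n : ℝ) ^ 2))
    (g' := fun (n : ℕ) t => r ^ n * (Real.cos (n * t) / n)) (y₀ := 0)
    (summable_geometric_of_lt_one hr0 hr) (fun n t => ?_) (fun n t => ?_) (by simp) y
  · refine (((((hasDerivAt_id t).const_mul (n : ℝ)).sin).div_const ((n : ℝ) ^ 2)).const_mul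
      (r ^ n)).congr_deriv ?_
    rcases n.eq_zero_or_pos with rfl | hn
    · simp
    · have : (n : ℝ) ≠ 0 := by positivity
      simp only [id]
      field_simp
  · rw [norm_mul, norm_pow, Real.norm_of_nonneg hr0]
    refine mul_le_of_le_one_right (by positivity) ?_
    rw [norm_div, RCLike.norm_natCast]
    rcases n.eq_zero_or_pos with rfl | hn
    · simp
    · have : (1 : ℝ) ≤ n := by exact_mod_cast hn
      exact div_le_one_of_le₀ ((Real.abs_cos_le_one _).trans this) (by positivity)

/-- The Fourier series of `log (2 sin (t / 2))` is not absolutely convergent, so the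
differentiation is done for the Abel means `∑ rⁿ sin (n t) / n²`, whose derivatives converge
locally uniformly as `r → 1⁻` because `(r, y) ↦ log ‖1 - r e^{iy}‖` is continuous near `(1, t)`. -/
theorem hasDerivAt_clausenTwo {t : ℝ} (h0 : 0 < t) (h1 : t < 2 * Real.pi) :
    HasDerivAt clausenTwo (-Real.log (2 * Real.sin (t / 2))) t := by
  have hs : 0 < Real.sin (t / 2) := Real.sin_pos_of_pos_of_lt_pi (by linarith) (by linarith)
  have hnorm : ‖1 - ((1 : ℝ) : ℂ) * Complex.exp (Complex.I * t)‖ = 2 * Real.sin (t / 2) := by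
    rw [Complex.ofReal_one, one_mul, norm_sub_rev, Complex.norm_exp_I_mul_ofReal_sub_one,
      Real.norm_of_nonneg (by positivity)]
  let F : ℝ → ℝ → ℝ := fun r y => -Real.log ‖1 - (r : ℂ) * Complex.exp (Complex.I * y)‖
  have hF : ContinuousAt (fun p : ℝ × ℝ => F p.1 p.2) (1, t) := by
    refine ContinuousAt.neg (ContinuousAt.log ?_ ?_)
    · exact Continuous.continuousAt (by fun_prop)
    · change ‖1 - ((1 : ℝ) : ℂ) * Complex.exp (Complex.I * t)‖ ≠ 0
      rw [hnorm]
      positivity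
  have hFt : F 1 t = -Real.log (2 * Real.sin (t / 2)) := by simp only [F, hnorm]
  rw [← hFt]
  refine hasDerivAt_of_tendstoUniformlyOnFilter (l := 𝓝[<] (1 : ℝ)) (f' := F) (g' := F 1)
    (f := fun r t => ∑' n : ℕ, r ^ n * (Real.sin (n * t) / (n : ℝ) ^ 2)) ?_ ?_ ?_
  · intro u hu
    have hle : 𝓝[<] (1 : ℝ) ×ˢ 𝓝 t ≤ 𝓝 ((1 : ℝ), t) := by
      rw [nhds_prod_eq]
      exact Filter.prod_mono nhdsWithin_le_nhds le_rfl
    have h2 : Tendsto (fun p : ℝ × ℝ => F p.1 p.2) (𝓝[<] (1 : ℝ) ×ˢ 𝓝 t) (𝓝 (F 1 t)) :=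
      hF.tendsto.mono_left hle
    have h3 : Tendsto (fun p : ℝ × ℝ => F 1 p.2) (𝓝[<] (1 : ℝ) ×ˢ 𝓝 t) (𝓝 (F 1 t)) := by
      have hc : Continuous fun p : ℝ × ℝ => ((1 : ℝ), p.2) := by fun_prop
      exact (hF.tendsto.comp (hc.tendsto (1, t))).mono_left hle
    have := h3.prodMk_nhds h2
    exact this.eventually (nhds_le_uniformity _ hu)
  · have : ∀ᶠ r : ℝ in 𝓝[<] (1 : ℝ), r ∈ Set.Ioo (0 : ℝ) 1 := Ioo_mem_nhdsLT one_pos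
    filter_upwards [this.prod_inl (𝓝 t)] with p hp
    exact hasDerivAt_tsum_pow_mul_sin_div_sq hp.1.le hp.2 p.2
  · refine Eventually.of_forall fun y => ?_
    refine tendsto_tsum_of_dominated_convergence summable_one_div_natCast_sq (fun n => ?_) ?_
    · have hc : Continuous fun r : ℝ => r ^ n * (Real.sin (n * y) / (n : ℝ) ^ 2) := by fun_prop
      simpa using (hc.tendsto 1).mono_left nhdsWithin_le_nhds
    · filter_upwards [Ioo_mem_nhdsLT (one_pos (α := ℝ))] with r hr n
      rw [norm_mul]
      refine (mul_le_of_le_one_left (norm_nonneg _) ?_).trans (norm_sin_div_natCast_sq_le n y)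
      rw [norm_pow, Real.norm_of_nonneg hr.1.le]
      exact pow_le_one₀ hr.1.le hr.2.le

/-! ### The central binomial series in terms of Clausen functions -/

theorem centralSeriesDiv_two_one_div_four :
    centralSeriesDiv 2 (1 / 4) = 2 * Real.pi / 3 * clausenTwo (Real.pi / 3) +
      2 * clausenThree (Real.pi / 3) - 2 * clausenThree 0 := by
  have hpi := Real.pi_pos
  -- `log (2 sin t) = log t + log (2 sinc t)` makes the continuity at `0` visible.
  let G : ℝ → ℝ := fun t => 4 * (t * (t * Real.log t) + t ^ 2 * Real.log (2 * Real.sinc t)) +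
    4 * t * clausenTwo (2 * t) + 2 * clausenThree (2 * t)
  have hG : ∀ t : ℝ, 0 < t → t < Real.pi → G t = 4 * t ^ 2 * Real.log (2 * Real.sin t) +
      4 * t * clausenTwo (2 * t) + 2 * clausenThree (2 * t) := by
    intro t ht0 ht1
    have hs := Real.sin_pos_of_pos_of_lt_pi ht0 ht1
    have : Real.log (2 * Real.sin t) = Real.log t + Real.log (2 * Real.sinc t) := by
      rw [Real.sinc_of_ne_zero ht0.ne', ← Real.log_mul ht0.ne' (by positivity)]
      congr 1
      field_simp
    simp only [G, this]
    ring
  have hsinc : ∀ t ∈ Set.Icc 0 (Real.pi / 6), 2 * Real.sinc t ≠ 0 := by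
    intro t ht
    rcases ht.1.eq_or_lt with rfl | h0
    · simp
    · have := Real.sin_pos_of_pos_of_lt_pi h0 (by linarith [ht.2])
      rw [Real.sinc_of_ne_zero h0.ne']
      positivity
  have hGc : ContinuousOn G (Set.Icc 0 (Real.pi / 6)) := by
    have h1 : ContinuousOn (fun t => Real.log (2 * Real.sinc t)) (Set.Icc 0 (Real.pi / 6)) :=
      (Real.continuous_sinc.const_mul 2).continuousOn.log hsinc
    have h2 := continuous_clausenTwo
    have h3 : Continuous clausenThree :=
      continuous_iff_continuousAt.mpr fun t => (hasDerivAt_clausenThree t).continuousAt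
    have h4 := Real.continuous_mul_log
    fun_prop
  have hS : ∀ t ∈ Set.Icc 0 (Real.pi / 6),
      ContinuousAt (fun t => centralSeriesDiv 2 (Real.sin t ^ 2)) t := fun t ht => by
    obtain ⟨d, hd, -⟩ := hasDerivAt_centralSeriesDiv_two (abs_sin_sq_lt_one ht.1 ht.2)
    exact (HasDerivAt.comp t hd (hasDerivAt_sin_sq t)).continuousAt
  have h := sub_eq_sub_of_hasDerivAt_eq (show (0 : ℝ) < Real.pi / 6 by positivity)
    (fun t ht => (hS t ht).continuousWithinAt) hGc
    (fun t ht => hasDerivAt_centralSeriesDiv_two_sin_sq ht.1 ht.2.le) (fun t ht => ?_)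
  · rw [hG (Real.pi / 6) (by positivity) (by linarith)] at h
    simp only [G, Real.sin_pi_div_six, Real.sin_zero] at h
    norm_num [centralSeriesDiv_zero] at h
    rw [show 2 * (Real.pi / 6) = Real.pi / 3 by ring] at h
    norm_num at h ⊢
    linarith
  · have ht' : t < Real.pi := by linarith [ht.2]
    have hs := Real.sin_pos_of_pos_of_lt_pi ht.1 ht'
    have h2 : HasDerivAt (fun t => clausenTwo (2 * t)) (-Real.log (2 * Real.sin t) * 2) t := by
      have := hasDerivAt_clausenTwo (t := 2 * t) (by linarith [ht.1]) (by linarith)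
      rw [mul_div_cancel_left₀ _ two_ne_zero] at this
      exact HasDerivAt.comp t this (by simpa using (hasDerivAt_id t).const_mul 2)
    have h3 : HasDerivAt (fun t => clausenThree (2 * t)) (-clausenTwo (2 * t) * 2) t :=
      HasDerivAt.comp t (hasDerivAt_clausenThree (2 * t))
        (by simpa using (hasDerivAt_id t).const_mul 2)
    have h1 : HasDerivAt (fun t => Real.log (2 * Real.sin t))
        (2 * Real.cos t / (2 * Real.sin t)) t :=
      ((Real.hasDerivAt_sin t).const_mul 2).log (by positivity)
    have h4 := ((((hasDerivAt_pow 2 t).const_mul 4).mul h1).add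
      (((hasDerivAt_id t).const_mul 4).mul h2)).add (h3.const_mul 2)
    refine (h4.congr_of_eventuallyEq ?_).congr_deriv ?_
    · filter_upwards [Ioo_mem_nhds ht.1 ht'] with s hs
      exact hG s hs.1 hs.2
    · have := hs.ne'
      simp only [id, Nat.cast_ofNat]
      field_simp
      ring

/-! ### Special values of the Clausen functions -/

/-- Alternating the signs of an absolutely convergent series through its even part. -/
theorem tsum_neg_one_pow_mul {f : ℕ → ℝ} (hf : Summable f) :
    ∑' n, (-1) ^ n * f n = 2 * ∑' n, f (2 * n) - ∑' n, f n := by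
  have hi : Function.Injective fun n : ℕ => 2 * n := fun a b h => by simpa using h
  have he : HasSum (fun n => if Even n then f n else 0) (∑' n, f (2 * n)) := by
    refine (hi.hasSum_iff fun n hn => ?_).mp ?_
    · rw [if_neg]
      rintro ⟨m, rfl⟩
      exact hn ⟨m, by simp; ring⟩
    · simpa [Function.comp_def] using (hf.comp_injective hi).hasSum
  refine HasSum.tsum_eq ((((he.mul_left 2).sub hf.hasSum)).congr_fun fun n => ?_)
  split_ifs with h
  · rw [h.neg_one_pow]; ring
  · rw [(Nat.not_even_iff_odd.mp h).neg_one_pow]; ring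

theorem hasSum_ite_mod_three {f : ℕ → ℝ} (hf : Summable f) {j : ℕ} (hj : j < 3) :
    HasSum (fun n => if n % 3 = j then f n else 0) (∑' n, f (3 * n + j)) := by
  have hi : Function.Injective fun n : ℕ => 3 * n + j := fun a b h => by simpa using h
  refine (hi.hasSum_iff fun n hn => ?_).mp ?_
  · rw [if_neg]
    intro h
    exact hn ⟨n / 3, by simp only; omega⟩
  · have : ∀ n, (3 * n + j) % 3 = j := fun n => by omega
    simpa [Function.comp_def, this] using (hf.comp_injective hi).hasSum

theorem cos_natCast_mul_two_pi_div_three (n : ℕ) :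
    Real.cos (n * (2 * Real.pi / 3)) = -(1 / 2) + 3 / 2 * (if n % 3 = 0 then 1 else 0) := by
  obtain ⟨q, r, hr, rfl⟩ : ∃ q r, r < 3 ∧ n = 3 * q + r :=
    ⟨n / 3, n % 3, Nat.mod_lt _ (by norm_num), (Nat.div_add_mod n 3).symm⟩
  rw [show ((3 * q + r : ℕ) : ℝ) * (2 * Real.pi / 3) = r * (2 * Real.pi / 3) + q * (2 * Real.pi) by
    push_cast; ring, Real.cos_add_nat_mul_two_pi]
  interval_cases r
  · simp
    norm_num
  · have : (1 : ℕ) * (2 * Real.pi / 3) = Real.pi - Real.pi / 3 := by push_cast; ring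
    rw [this, Real.cos_pi_sub, Real.cos_pi_div_three, if_neg (by omega)]
    norm_num
  · have : (2 : ℕ) * (2 * Real.pi / 3) = Real.pi / 3 + Real.pi := by push_cast; ring
    rw [this, Real.cos_add_pi, Real.cos_pi_div_three, if_neg (by omega)]
    norm_num

theorem sin_natCast_mul_two_pi_div_three (n : ℕ) :
    Real.sin (n * (2 * Real.pi / 3)) =
      √3 / 2 * ((if n % 3 = 1 then 1 else 0) - (if n % 3 = 2 then 1 else 0)) := by
  obtain ⟨q, r, hr, rfl⟩ : ∃ q r, r < 3 ∧ n = 3 * q + r :=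
    ⟨n / 3, n % 3, Nat.mod_lt _ (by norm_num), (Nat.div_add_mod n 3).symm⟩
  rw [show ((3 * q + r : ℕ) : ℝ) * (2 * Real.pi / 3) = r * (2 * Real.pi / 3) + q * (2 * Real.pi) by
    push_cast; ring, Real.sin_add_nat_mul_two_pi]
  interval_cases r
  · simp
  · have : (1 : ℕ) * (2 * Real.pi / 3) = Real.pi - Real.pi / 3 := by push_cast; ring
    rw [this, Real.sin_pi_sub, Real.sin_pi_div_three, if_pos (by omega), if_neg (by omega)]
    norm_num
  · have : (2 : ℕ) * (2 * Real.pi / 3) = Real.pi / 3 + Real.pi := by push_cast; ring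
    rw [this, Real.sin_add_pi, Real.sin_pi_div_three, if_neg (by omega), if_pos (by omega)]
    norm_num

theorem clausenThree_two_pi_div_three :
    clausenThree (2 * Real.pi / 3) = -(4 / 9) * clausenThree 0 := by
  have hs : Summable fun n : ℕ => 1 / (n : ℝ) ^ 3 :=
    Real.summable_one_div_nat_pow.mpr (by norm_num)
  have h0 : clausenThree 0 = ∑' n : ℕ, 1 / (n : ℝ) ^ 3 := by simp [clausenThree]
  have h3 : ∑' n : ℕ, 1 / ((3 * n + 0 : ℕ) : ℝ) ^ 3 = 1 / 27 * clausenThree 0 := by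
    rw [h0, ← tsum_mul_left]
    refine tsum_congr fun n => ?_
    push_cast
    rw [add_zero, mul_pow, one_div_mul_one_div]
    norm_num
  have h := (hs.hasSum.mul_left (-(1 / 2))).add
    ((hasSum_ite_mod_three hs (j := 0) (by norm_num)).mul_left (3 / 2))
  rw [h3, ← h0] at h
  have h' : clausenThree (2 * Real.pi / 3) = _ := HasSum.tsum_eq (h.congr_fun fun n => by
    rw [cos_natCast_mul_two_pi_div_three]
    split_ifs <;> ring)
  rw [h']
  ring

theorem clausenThree_pi_div_three :
    clausenThree (Real.pi / 3) = 1 / 3 * clausenThree 0 := by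
  have h := tsum_neg_one_pow_mul (summable_clausenThree (2 * Real.pi / 3))
  have h1 : clausenThree (Real.pi / 3) =
      ∑' n : ℕ, (-1) ^ n * (Real.cos (n * (2 * Real.pi / 3)) / (n : ℝ) ^ 3) := by
    refine tsum_congr fun n => ?_
    rw [show n * (Real.pi / 3) = n * Real.pi - n * (2 * Real.pi / 3) by ring,
      Real.cos_nat_mul_pi_sub, mul_div_assoc]
  have h2 : ∑' n : ℕ, Real.cos ((2 * n : ℕ) * (2 * Real.pi / 3)) / ((2 * n : ℕ) : ℝ) ^ 3 =
      1 / 8 * clausenThree (2 * Real.pi / 3) := by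
    rw [clausenThree, ← tsum_mul_left]
    refine tsum_congr fun n => ?_
    have : Real.cos ((2 * n : ℕ) * (2 * Real.pi / 3)) = Real.cos (n * (2 * Real.pi / 3)) := by
      rw [cos_natCast_mul_two_pi_div_three, cos_natCast_mul_two_pi_div_three]
      congr 3
      simp only [eq_iff_iff]
      omega
    rw [this]
    push_cast
    rw [mul_pow, div_mul_div_comm, one_mul]
    norm_num
  rw [h1, h, h2, ← clausenThree, clausenThree_two_pi_div_three]
  ring

theorem clausenTwo_two_pi_div_three :
    clausenTwo (2 * Real.pi / 3) = √3 / 2 * (∑' n : ℕ, 1 / ((3 * n + 1 : ℕ) : ℝ) ^ 2 -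
      ∑' n : ℕ, 1 / ((3 * n + 2 : ℕ) : ℝ) ^ 2) := by
  have hs := summable_one_div_natCast_sq
  have h := ((hasSum_ite_mod_three hs (j := 1) (by norm_num)).sub
    (hasSum_ite_mod_three hs (j := 2) (by norm_num))).mul_left (√3 / 2)
  exact HasSum.tsum_eq (h.congr_fun fun n => by
    rw [sin_natCast_mul_two_pi_div_three]
    split_ifs <;> ring)

theorem clausenTwo_pi_div_three :
    clausenTwo (Real.pi / 3) = 3 / 2 * clausenTwo (2 * Real.pi / 3) := by
  have h := tsum_neg_one_pow_mul (summable_clausenTwo (2 * Real.pi / 3))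
  have h1 : clausenTwo (Real.pi / 3) =
      -∑' n : ℕ, (-1) ^ n * (Real.sin (n * (2 * Real.pi / 3)) / (n : ℝ) ^ 2) := by
    rw [← tsum_neg]
    refine tsum_congr fun n => ?_
    rw [show n * (Real.pi / 3) = n * Real.pi - n * (2 * Real.pi / 3) by ring,
      Real.sin_nat_mul_pi_sub]
    ring
  have h2 : ∑' n : ℕ, Real.sin ((2 * n : ℕ) * (2 * Real.pi / 3)) / ((2 * n : ℕ) : ℝ) ^ 2 =
      -(1 / 4) * clausenTwo (2 * Real.pi / 3) := by
    rw [clausenTwo, ← tsum_mul_left]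
    refine tsum_congr fun n => ?_
    have : Real.sin ((2 * n : ℕ) * (2 * Real.pi / 3)) = -Real.sin (n * (2 * Real.pi / 3)) := by
      have h1 : 2 * n % 3 = 1 ↔ n % 3 = 2 := by omega
      have h2 : 2 * n % 3 = 2 ↔ n % 3 = 1 := by omega
      simp only [sin_natCast_mul_two_pi_div_three, h1, h2]
      ring
    rw [this]
    push_cast
    rw [mul_pow]
    ring
  rw [h1, h, h2, ← clausenTwo]
  ring

/-! ### The series of the trigamma function -/

theorem differentiableAt_log_Gamma {x : ℝ} (hx : 0 < x) :
    DifferentiableAt ℝ (Real.log ∘ Real.Gamma) x :=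
  (Real.differentiableAt_Gamma fun m => by
    have : (0 : ℝ) ≤ m := m.cast_nonneg
    linarith).log (Real.Gamma_pos_of_pos hx).ne'

theorem deriv_log_Gamma_add_one {x : ℝ} (hx : 0 < x) :
    deriv (Real.log ∘ Real.Gamma) (x + 1) = deriv (Real.log ∘ Real.Gamma) x + 1 / x := by
  rw [← deriv_comp_add_const, one_div, ← Real.deriv_log,
    ← deriv_add (differentiableAt_log_Gamma hx) (Real.differentiableAt_log hx.ne')]
  apply EventuallyEq.deriv_eq
  filter_upwards [eventually_gt_nhds hx] with y hy
  simp only [Function.comp_apply, Pi.add_apply]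
  rw [Real.Gamma_add_one hy.ne', Real.log_mul hy.ne' (Real.Gamma_pos_of_pos hy).ne', add_comm]

theorem deriv_log_Gamma_add_natCast {x : ℝ} (hx : 0 < x) (n : ℕ) :
    deriv (Real.log ∘ Real.Gamma) (x + n) =
      deriv (Real.log ∘ Real.Gamma) x + ∑ k ∈ Finset.range n, 1 / (x + k) := by
  induction n with
  | zero => simp
  | succ n ih =>
    rw [Nat.cast_succ, ← add_assoc, deriv_log_Gamma_add_one (by positivity), ih,
      Finset.sum_range_succ, add_assoc]

theorem monotoneOn_deriv_log_Gamma :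
    MonotoneOn (deriv (Real.log ∘ Real.Gamma)) (Set.Ioi 0) :=
  Real.convexOn_log_Gamma.monotoneOn_deriv fun _ hx => differentiableAt_log_Gamma hx

/-- By log-convexity of `Γ`, the difference of the logarithmic derivatives of `Γ` at `1 + n` and
`x + n` is squeezed between `0` and the increment `1 / n` over a unit step. -/
theorem hasSum_deriv_log_Gamma_sub {x : ℝ} (hx : 0 < x) (hx1 : x < 1) :
    HasSum (fun k : ℕ => 1 / (x + k) - 1 / (1 + k))
      (deriv (Real.log ∘ Real.Gamma) 1 - deriv (Real.log ∘ Real.Gamma) x) := by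
  set d := deriv (Real.log ∘ Real.Gamma)
  rw [hasSum_iff_tendsto_nat_of_nonneg fun k => by
    rw [sub_nonneg]
    gcongr]
  have hlim : Tendsto (fun n : ℕ => d (1 + n) - d (x + n)) atTop (𝓝 0) := by
    refine tendsto_of_tendsto_of_tendsto_of_le_of_le' tendsto_const_nhds
      tendsto_one_div_atTop_nhds_zero_nat ?_ ?_
    · refine Eventually.of_forall fun n => sub_nonneg.mpr ?_
      exact monotoneOn_deriv_log_Gamma (Set.mem_Ioi.mpr (by positivity))
        (Set.mem_Ioi.mpr (by positivity)) (by linarith)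
    · filter_upwards [eventually_gt_atTop 0] with n hn
      have hn' : (0 : ℝ) < n := by exact_mod_cast hn
      have h1 := deriv_log_Gamma_add_one hn'
      have h2 : d n ≤ d (x + n) := monotoneOn_deriv_log_Gamma hn'
        (Set.mem_Ioi.mpr (by positivity)) (by linarith)
      rw [add_comm 1 (n : ℝ)]
      linarith
  have h : (fun n : ℕ => ∑ k ∈ Finset.range n, (1 / (x + k) - 1 / (1 + (k : ℝ)))) =
      fun n : ℕ => d 1 - d x - (d (1 + n) - d (x + n)) := by
    funext n
    have h1 := deriv_log_Gamma_add_natCast hx n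
    have h2 := deriv_log_Gamma_add_natCast one_pos n
    rw [Finset.sum_sub_distrib]
    linarith
  rw [h]
  simpa using hlim.const_sub (d 1 - d x)

theorem summable_one_div_add_natCast_sq {x : ℝ} (hx : 0 < x) :
    Summable fun k : ℕ => 1 / (x + k) ^ 2 := by
  refine ((Real.summable_one_div_nat_add_rpow x 2).mpr one_lt_two).congr fun k => ?_
  rw [abs_of_pos (by positivity), add_comm, Real.rpow_two]

theorem hasDerivAt_deriv_log_Gamma {x : ℝ} (hx : 0 < x) (hx1 : x < 1) :
    HasDerivAt (deriv (Real.log ∘ Real.Gamma)) (∑' k : ℕ, 1 / (x + k) ^ 2) x := by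
  have hderiv : ∀ (k : ℕ) (y : ℝ), y ∈ Set.Ioo (x / 2) 1 →
      HasDerivAt (fun y : ℝ => 1 / (y + k) - 1 / (1 + k)) (-(1 / (y + k) ^ 2)) y := by
    intro k y hy
    have hy' : y + k ≠ 0 := by
      have := (half_pos hx).trans hy.1
      positivity
    have := (((hasDerivAt_id y).add_const (k : ℝ)).inv hy').sub_const (1 / (1 + (k : ℝ)))
    simpa [one_div, neg_div] using this
  have h := hasDerivAt_tsum_of_isPreconnected (t := Set.Ioo (x / 2) 1) (y₀ := x)
    (summable_one_div_add_natCast_sq (half_pos hx)) isOpen_Ioo isPreconnected_Ioo hderiv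
    (fun k y hy => by
      have h0 := half_pos hx
      have h1 := hy.1.le
      rw [norm_neg, Real.norm_of_nonneg (by positivity)]
      gcongr) ⟨by linarith, hx1⟩ (hasSum_deriv_log_Gamma_sub hx hx1).summable
    ⟨by linarith, hx1⟩
  rw [tsum_neg] at h
  have h' := h.const_sub (deriv (Real.log ∘ Real.Gamma) 1)
  rw [neg_neg] at h'
  refine h'.congr_of_eventuallyEq ?_
  filter_upwards [Ioo_mem_nhds hx hx1] with y hy
  rw [(hasSum_deriv_log_Gamma_sub hy.1 hy.2).tsum_eq]
  ring

theorem digamma_ofReal {x : ℝ} (hx : 0 < x) :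
    Complex.digamma x = (deriv (Real.log ∘ Real.Gamma) x : ℝ) := by
  have hx' : ∀ m : ℕ, x ≠ -m := fun m => by
    have : (0 : ℝ) ≤ m := m.cast_nonneg
    linarith
  have h1 := (Real.differentiableAt_Gamma hx').hasDerivAt
  have h2 := (Complex.differentiableAt_Gamma x fun m => by
    exact_mod_cast hx' m).hasDerivAt.comp_ofReal
  have h3 := h1.ofReal_comp
  simp only [Complex.Gamma_ofReal] at h2
  have h4 : deriv (Real.log ∘ Real.Gamma) x = deriv Real.Gamma x / Real.Gamma x :=
    (h1.log (Real.Gamma_pos_of_pos hx).ne').deriv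
  rw [Complex.digamma_def, logDeriv_apply, h2.unique h3, Complex.Gamma_ofReal, h4,
    Complex.ofReal_div]

theorem trigamma_ofReal {x : ℝ} (hx : 0 < x) (hx1 : x < 1) :
    trigamma x = ((∑' k : ℕ, 1 / (x + k) ^ 2 : ℝ) : ℂ) := by
  have hU : IsOpen {s : ℂ | 0 < s.re} := isOpen_lt continuous_const Complex.continuous_re
  have hG : DifferentiableOn ℂ Complex.Gamma {s : ℂ | 0 < s.re} := fun s hs =>
    (Complex.differentiableAt_Gamma s fun m hm => by
      have hs' : 0 < s.re := hs
      rw [hm, Complex.neg_re, Complex.natCast_re] at hs'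
      linarith [m.cast_nonneg (α := ℝ)]).differentiableWithinAt
  have hmem : (x : ℂ) ∈ {s : ℂ | 0 < s.re} := by simpa using hx
  have hd : DifferentiableAt ℂ Complex.digamma x :=
    ((hG.deriv hU).differentiableAt (hU.mem_nhds hmem)).div
      (hG.differentiableAt (hU.mem_nhds hmem))
      (Complex.Gamma_ne_zero_of_re_pos hmem)
  have h1 := hd.hasDerivAt.comp_ofReal
  refine h1.unique ((hasDerivAt_deriv_log_Gamma hx hx1).ofReal_comp.congr_of_eventuallyEq ?_)
  filter_upwards [eventually_gt_nhds hx] with y hy using digamma_ofReal hy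

theorem trigamma_natCast_div_three {j : ℕ} (hj : 0 < j) (hj3 : j < 3) :
    trigamma (j / 3) = ((9 * ∑' n : ℕ, 1 / ((3 * n + j : ℕ) : ℝ) ^ 2 : ℝ) : ℂ) := by
  have hj' : (0 : ℝ) < j := by exact_mod_cast hj
  have hj3' : (j : ℝ) < 3 := by exact_mod_cast hj3
  rw [show (j / 3 : ℂ) = ((j / 3 : ℝ) : ℂ) by push_cast; rfl,
    trigamma_ofReal (by positivity) (by linarith), ← tsum_mul_left]
  congr 1
  refine tsum_congr fun n => ?_
  push_cast
  field_simp
  ring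

/-! ### Evaluation and numerical value -/

theorem hasSum_centralBinom_cube :
    HasSum (fun n : ℕ => 1 / ((n : ℝ) ^ 3 * n.centralBinom)) (centralSeriesDiv 2 (1 / 4)) := by
  refine (summable_mul_pow_of_bounded (abs_centralCoeff_div_pow_le 2)
    (by norm_num [abs_of_pos] : |(1 / 4 : ℝ)| < 1)).hasSum.congr_fun fun n => ?_
  have := n.centralBinom_pos
  rcases n.eq_zero_or_pos with rfl | hn
  · simp [centralCoeff_zero]
  · rw [centralCoeff, div_pow, one_pow]
    field_simp

theorem abs_centralSeriesDiv_sub_lt : |centralSeriesDiv 2 (1 / 4) - 0.5229| < 0.00005 := by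
  set a : ℕ → ℝ := fun n => 1 / ((n : ℝ) ^ 3 * n.centralBinom) with ha
  have hsum : HasSum a (centralSeriesDiv 2 (1 / 4)) := hasSum_centralBinom_cube
  have ha0 : ∀ n, 0 ≤ a n := fun n => by positivity
  -- Successive central binomial coefficients have ratio `4 (2 m + 1) / (2 m + 2)`, slightly less
  -- than `4`; the growth of the cubes makes up for the difference.
  have hratio : ∀ n : ℕ, a (n + 1 + 1) ≤ a (n + 1) * (1 / 4) := by
    intro n
    have h : ((n : ℝ) + 1 + 1) * (n + 1 + 1).centralBinom
        = 2 * (2 * (n + 1) + 1) * (n + 1).centralBinom := by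
      exact_mod_cast Nat.succ_mul_centralBinom_succ (n + 1)
    have hc : (0 : ℝ) < (n + 1).centralBinom := by exact_mod_cast (n + 1).centralBinom_pos
    simp only [ha]
    push_cast
    rw [show ((n : ℝ) + 1 + 1) ^ 3 * (n + 1 + 1).centralBinom =
      (n + 1 + 1) ^ 2 * (2 * (2 * (n + 1) + 1) * (n + 1).centralBinom) by rw [← h]; ring,
      one_div_mul_one_div]
    apply one_div_le_one_div_of_le (by positivity)
    have : ((n : ℝ) + 1) ^ 3 * 4 ≤ (n + 1 + 1) ^ 2 * (2 * (2 * (n + 1) + 1)) := by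
      have : (0 : ℝ) ≤ n := n.cast_nonneg
      nlinarith [pow_nonneg this 3, pow_nonneg this 2]
    nlinarith
  have hgeo : ∀ k, a (k + 6) ≤ a 6 * (1 / 4) ^ k := by
    intro k
    induction k with
    | zero => simp
    | succ k ih =>
      calc a (k + 1 + 6) ≤ a (k + 6) * (1 / 4) := hratio (k + 5)
        _ ≤ a 6 * (1 / 4) ^ (k + 1) := by rw [pow_succ]; linarith
  have htail : HasSum (fun k => a (k + 6))
      (centralSeriesDiv 2 (1 / 4) - ∑ i ∈ Finset.range 6, a i) := (hasSum_nat_add_iff' 6).mpr hsum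
  have hle := hasSum_le hgeo htail
    ((hasSum_geometric_of_lt_one (by norm_num) (by norm_num : (1 / 4 : ℝ) < 1)).mul_left (a 6))
  have hge := htail.nonneg fun k => ha0 _
  simp only [Finset.sum_range_succ, Finset.sum_range_zero, ha,
    show Nat.centralBinom 1 = 2 by decide, show Nat.centralBinom 2 = 6 by decide,
    show Nat.centralBinom 3 = 20 by decide, show Nat.centralBinom 4 = 70 by decide,
    show Nat.centralBinom 5 = 252 by decide, show Nat.centralBinom 6 = 924 by decide] at hle hge
  norm_num at hle hge
  rw [abs_lt]
  constructor <;> norm_num <;> linarith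

theorem centralSeriesDiv_eq_riemannZeta_trigamma :
    ((centralSeriesDiv 2 (1 / 4) : ℝ) : ℂ) = -(4 / 3) * riemannZeta 3 +
      (Real.pi : ℂ) * (Real.sqrt 3 : ℂ) / 18 * (trigamma (1 / 3) - trigamma (2 / 3)) := by
  have hz : riemannZeta 3 = (clausenThree 0 : ℝ) := by
    have := zeta_nat_eq_tsum_of_gt_one (k := 3) (by norm_num)
    rw [Nat.cast_ofNat] at this
    rw [this]
    simp [clausenThree, Complex.ofReal_tsum]
  have h1 := trigamma_natCast_div_three (j := 1) (by norm_num) (by norm_num)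
  have h2 := trigamma_natCast_div_three (j := 2) (by norm_num) (by norm_num)
  rw [Nat.cast_one] at h1
  rw [Nat.cast_ofNat] at h2
  rw [hz, h1, h2, centralSeriesDiv_two_one_div_four, clausenTwo_pi_div_three,
    clausenTwo_two_pi_div_three, clausenThree_pi_div_three]
  push_cast
  ring

theorem mainTheorem1 :
    HasSum (fun m : ℕ+ => 1 / (((m : ℕ) : ℂ) ^ 3 * (Nat.choose (2 * (m : ℕ)) (m : ℕ) : ℂ)))
      (-(4 / 3) * riemannZeta 3 +
        (Real.pi : ℂ) * (Real.sqrt 3 : ℂ) / 18 * (trigamma (1 / 3) - trigamma (2 / 3))) ∧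
    HasSum (fun n : ℕ+ => (Nat.factorial (n : ℕ) : ℂ) ^ 2 /
        (((n : ℕ) : ℂ) ^ 3 * (Nat.factorial (2 * (n : ℕ)) : ℂ)))
      (4 * ((Real.pi : ℂ) * (Real.sqrt 3 : ℂ) / 72 * (trigamma (1 / 3) - trigamma (2 / 3)) -
        1 / 3 * riemannZeta 3)) ∧
    ‖-(4 / 3) * riemannZeta 3 +
        (Real.pi : ℂ) * (Real.sqrt 3 : ℂ) / 18 * (trigamma (1 / 3) - trigamma (2 / 3)) -
        (0.5229 : ℂ)‖ < 0.00005 := by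
  have h1 : HasSum (fun m : ℕ+ =>
        1 / (((m : ℕ) : ℂ) ^ 3 * (Nat.choose (2 * (m : ℕ)) (m : ℕ) : ℂ)))
      (-(4 / 3) * riemannZeta 3 +
        (Real.pi : ℂ) * (Real.sqrt 3 : ℂ) / 18 * (trigamma (1 / 3) - trigamma (2 / 3))) := by
    rw [← centralSeriesDiv_eq_riemannZeta_trigamma]
    have h := (PNat.coe_injective.hasSum_iff fun n hn => ?_).mpr hasSum_centralBinom_cube
    · have h' := Complex.hasSum_ofReal.mpr h
      refine h'.congr_fun fun m => ?_
      simp [Nat.centralBinom]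
    · have : n = 0 := by
        by_contra h0
        exact hn ⟨⟨n, Nat.pos_of_ne_zero h0⟩, rfl⟩
      simp [this]
  refine ⟨h1, ?_, ?_⟩
  · convert! h1 using 1
    · funext n
      have h : ((2 * n : ℕ).choose n : ℂ) * (n : ℕ).factorial ^ 2 = (2 * (n : ℕ)).factorial := by
        have := Nat.choose_mul_factorial_mul_factorial (show (n : ℕ) ≤ 2 * n by omega)
        rw [show 2 * (n : ℕ) - n = n by omega] at this
        rw [← this]
        push_cast
        ring
      have hf : ((n : ℕ).factorial : ℂ) ≠ 0 := by exact_mod_cast (n : ℕ).factorial_ne_zero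
      rw [← h]
      field_simp
    · ring
  · rw [← centralSeriesDiv_eq_riemannZeta_trigamma]
    have := abs_centralSeriesDiv_sub_lt
    rw [← Real.norm_eq_abs, ← Complex.norm_real] at this
    push_cast at this
    exact this
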